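/- Let $G(m,n)$ be the random two-player game in which Row has $m$ actions and Column has $n$ actions, for each action of Column Row's ordinal payoffs over her actions form a uniformly random permutation of $\{1,\dots,m\}$, for each action of Row Column's ordinal payoffs over his actions form a uniformly random permutation of $\{1,\dots,n\}$, and these $m+n$ permutations are mutually independent. In iterated elimination of strictly dominated actions, at each iteration both players simultaneously delete all their actions that are strictly dominated, in the remaining game, by another remaining pure action. Let $S^R(m,n)$ and $S^C(m,n)$ be the numbers of Row's and of Column's actions that are never deleted. Let $m=m(n)$ satisfy $2\le m(n)\le n$ for all $n\ge 2$. Then: 1. $\lim_{n\to\infty}\Pr\left(S^R(m,n)<m\right)=0$; moreover, the probability that Column deletes some action at an iteration after the first one tends to $0$. 2. If $m=o(\ln n)$, then $\lim_{n\to\infty}\frac{(m-1)!}{(\ln n)^{m-1}}\,\mathbb{E}\left[S^C(m,n)\right]=1$, and $\lim_{n\to\infty}\frac{\mathbb{E}[S^C(m,n)]}{n}=0$. 3. If $m-\log_2 n\to\infty$, then $\lim_{n\to\infty}\frac{\mathbb{E}[S^C(m,n)]}{n}=1$. If $m-2\log_2 n\to\infty$, then $\mathbb{E}[S^C(m,n)]=n-o(1)$.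 -/

import Mathlib

open Filter Topology Asymptotics

noncomputable section

namespace RandomGame

/-- An `m × n` game, given by the ordinal payoffs: for each action `j` of Column a ranking of
Row's actions, and for each action `i` of Row a ranking of Column's actions. -/
abbrev Game (m n : ℕ) : Type :=
  (Fin n → Equiv.Perm (Fin m)) × (Fin m → Equiv.Perm (Fin n))

variable {m n : ℕ}

/-- Row's payoff at the action profile `(i, j)` (higher is better). -/
def rowPayoff (g : Game m n) (i : Fin m) (j : Fin n) : Fin m := g.1 j i

/-- Column's payoff at the action profile `(i, j)` (higher is better). -/
def colPayoff (g : Game m n) (i : Fin m) (j : Fin n) : Fin n := g.2 i j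

/-- In the subgame with remaining actions `A` of Row and `B` of Column, Row's action `i` is
strictly dominated by some remaining pure action. -/
def RowDominated (g : Game m n) (A : Finset (Fin m)) (B : Finset (Fin n)) (i : Fin m) : Prop :=
  ∃ i' ∈ A, ∀ j ∈ B, rowPayoff g i j < rowPayoff g i' j

/-- In the subgame with remaining actions `A` of Row and `B` of Column, Column's action `j` is
strictly dominated by some remaining pure action. -/
def ColDominated (g : Game m n) (A : Finset (Fin m)) (B : Finset (Fin n)) (j : Fin n) : Prop :=
  ∃ j' ∈ B, ∀ i ∈ A, colPayoff g i j < colPayoff g i j'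

open Classical in
/-- One iteration: both players simultaneously delete all their strictly dominated actions. -/
def eliminate (g : Game m n) (S : Finset (Fin m) × Finset (Fin n)) :
    Finset (Fin m) × Finset (Fin n) :=
  (S.1.filter fun i => ¬ RowDominated g S.1 S.2 i,
   S.2.filter fun j => ¬ ColDominated g S.1 S.2 j)

/-- The remaining actions of Row and Column after `k` iterations. -/
def remaining (g : Game m n) (k : ℕ) : Finset (Fin m) × Finset (Fin n) :=
  (eliminate g)^[k] (Finset.univ, Finset.univ)

/-- `S^R`: the number of Row's actions that are never eliminated. -/
def survivingRow (g : Game m n) : ℕ :=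
  {i : Fin m | ∀ k, i ∈ (remaining g k).1}.ncard

/-- `S^C`: the number of Column's actions that are never eliminated. -/
def survivingCol (g : Game m n) : ℕ :=
  {j : Fin n | ∀ k, j ∈ (remaining g k).2}.ncard

open Classical in
/-- Probability of an event in the random game `G(m, n)`: the `n + m` rankings are independent and
each is uniform, which is to say that the game is uniform on the product `Game m n`. -/
def prob (m n : ℕ) (P : Game m n → Prop) : ℝ :=
  ((Finset.univ.filter P).card : ℝ) / (Fintype.card (Game m n) : ℝ)

/-- Expectation of a random variable in the random game `G(m, n)`. -/
def expect (m n : ℕ) (X : Game m n → ℝ) : ℝ :=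
  (∑ g : Game m n, X g) / (Fintype.card (Game m n) : ℝ)

/-- `E[S^C(m, n)]`. -/
def meanSurvivingCol (m n : ℕ) : ℝ :=
  expect m n fun g => (survivingCol g : ℝ)

end RandomGame

end

noncomputable section

namespace RandomGame

open scoped BigOperators

open Equiv

variable {m n : ℕ}

/-! After the first iteration exactly the columns undominated in the full game remain; let `maxima`
be their number. If Row has no dominated action against these columns (`¬ RowReacts`), then Row had
none against all columns either, so the process stops there: Row keeps everything and `survivingCol
= maxima`. In general `survivingCol ≤ maxima`.

Given Column's rankings, each pair of Row's actions is a row domination with probability at most `2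
^ (-maxima)`, so `freq_rowReacts_le` bounds the chance of a reaction by `m² 2 ^ (-maxima)`. It
remains to show that `maxima` is rarely small. For small `m`, two of Column's rankings alone produce
about `har n` undominated columns (records, by Chebyshev); for large `m`, few columns are dominated
at all (union bound over pairs, by Markov). The same estimates show that the mean of `maxima` and
`meanSurvivingCol` are close.

The mean of `maxima` is exactly `hsum (m - 1) n`, the complete homogeneous polynomial in `1, 1/2, …,
1/n` (`expect_maxima_eq_hsum`). Newton's identity compares it with `har n ^ (m - 1) / (m - 1)!`,
sharply when `m = o(log n)`. When `m` exceeds `log₂ n` or `2 log₂ n`, the bound `n² 2 ^ (-m)` on the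
mean number of dominated columns suffices. -/

open Classical in
/-- The real-valued indicator of a proposition. -/
def ind (P : Prop) : ℝ := if P then 1 else 0

lemma ind_true {P : Prop} (h : P) : ind P = 1 := if_pos h

lemma ind_false {P : Prop} (h : ¬ P) : ind P = 0 := if_neg h

lemma ind_nonneg (P : Prop) : 0 ≤ ind P := by
  unfold ind; split_ifs <;> norm_num

lemma ind_le_one (P : Prop) : ind P ≤ 1 := by
  unfold ind; split_ifs <;> norm_num

lemma ind_mono {P Q : Prop} (h : P → Q) : ind P ≤ ind Q := by
  by_cases hP : P
  · rw [ind_true hP, ind_true (h hP)]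
  · rw [ind_false hP]; exact ind_nonneg Q

lemma ind_congr {P Q : Prop} (h : P ↔ Q) : ind P = ind Q := by rw [propext h]

lemma ind_and (P Q : Prop) : ind (P ∧ Q) = ind P * ind Q := by
  by_cases hP : P <;> by_cases hQ : Q <;> simp [ind, hP, hQ]

lemma ind_add_ind_not (P : Prop) : ind P + ind (¬ P) = 1 := by
  by_cases hP : P <;> simp [ind, hP]

lemma ind_exists_le_sum {ι : Type*} [Fintype ι] (P : ι → Prop) :
    ind (∃ i, P i) ≤ ∑ i, ind (P i) := by
  by_cases h : ∃ i, P i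
  · obtain ⟨i, hi⟩ := h
    calc ind (∃ i, P i) ≤ 1 := ind_le_one _
      _ = ind (P i) := (ind_true hi).symm
      _ ≤ _ := Finset.single_le_sum (f := fun i => ind (P i)) (fun i _ => ind_nonneg _)
        (Finset.mem_univ i)
  · rw [ind_false h]
    exact Finset.sum_nonneg fun i _ => ind_nonneg _

lemma prod_ind {ι : Type*} [Fintype ι] (P : ι → Prop) :
    ∏ i, ind (P i) = ind (∀ i, P i) := by
  by_cases h : ∀ i, P i
  · rw [ind_true h]; exact Finset.prod_eq_one fun i _ => ind_true (h i)
  · rw [ind_false h]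
    push Not at h
    obtain ⟨i, hi⟩ := h
    exact Finset.prod_eq_zero (Finset.mem_univ i) (ind_false hi)

lemma card_filter_eq_sum_ind {ι : Type*} (s : Finset ι) (P : ι → Prop) [DecidablePred P] :
    ((s.filter P).card : ℝ) = ∑ i ∈ s, ind (P i) := by
  rw [Finset.card_filter]
  push_cast
  refine Finset.sum_congr rfl fun i _ => ?_
  by_cases h : P i <;> simp [ind, h]

/-- The proportion of the elements of a finite type that satisfy `P`. -/
def freq {α : Type*} [Fintype α] (P : α → Prop) : ℝ := 𝔼 a, ind (P a)

/-! ### Proportions and averages over finite types and products -/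

section freq

variable {α : Type*} [Fintype α]

lemma expect_le_expect_of_le {f g : α → ℝ} (h : ∀ a, f a ≤ g a) : 𝔼 a, f a ≤ 𝔼 a, g a :=
  Finset.expect_le_expect fun a _ => h a

lemma freq_nonneg (P : α → Prop) : 0 ≤ freq P := Finset.expect_nonneg fun _ _ => ind_nonneg _

lemma freq_mono {P Q : α → Prop} (h : ∀ a, P a → Q a) : freq P ≤ freq Q :=
  expect_le_expect_of_le fun a => ind_mono (h a)

lemma freq_le_one [Nonempty α] (P : α → Prop) : freq P ≤ 1 :=
  Finset.expect_le Finset.univ_nonempty fun _ _ => ind_le_one _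

/-- Markov's inequality. -/
lemma mul_freq_le_expect {f : α → ℝ} (hf : ∀ a, 0 ≤ f a) (c : ℝ) {P : α → Prop}
    (hP : ∀ a, P a → c ≤ f a) : c * freq P ≤ 𝔼 a, f a := by
  rw [freq, Finset.mul_expect]
  refine expect_le_expect_of_le fun a => ?_
  by_cases h : P a
  · rw [ind_true h, mul_one]; exact hP a h
  · rw [ind_false h, mul_zero]; exact hf a

lemma freq_pi {ι : Type*} [Fintype ι] [DecidableEq ι] (P : ι → α → Prop) :
    freq (fun f : ι → α => ∀ i, P i (f i)) = ∏ i, freq (P i) := by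
  simp only [freq, Fintype.expect_eq_sum_div_card, Finset.prod_div_distrib]
  rw [Finset.prod_univ_sum]
  simp [prod_ind, Fintype.piFinset_univ]

lemma expect_pi_succ {k : ℕ} (F : (Fin (k + 1) → α) → ℝ) :
    𝔼 c, F c = 𝔼 a, 𝔼 c : Fin k → α, F (Fin.cons a c) := by
  rw [← Finset.expect_product', Finset.univ_product_univ]
  exact (Fintype.expect_equiv (Fin.consEquiv fun _ => α) _ _ fun _ => rfl).symm

end freq

/-! ### Ranks and tops in a uniformly random permutation -/

section perm

lemma expect_perm_mul_right (τ : Perm (Fin n)) (F : Perm (Fin n) → ℝ) :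
    𝔼 σ, F (σ * τ) = 𝔼 σ, F σ :=
  Fintype.expect_equiv (Equiv.mulRight τ) _ _ fun _ => rfl

lemma freq_perm_lt {j j' : Fin n} (h : j ≠ j') :
    freq (fun σ : Perm (Fin n) => σ j < σ j') = 1 / 2 := by
  have h1 : freq (fun σ : Perm (Fin n) => σ j' < σ j) = freq fun σ : Perm (Fin n) => σ j < σ j' := by
    unfold freq
    rw [← expect_perm_mul_right (swap j j')]
    simp
  have h2 : freq (fun σ : Perm (Fin n) => σ j < σ j') +
      freq (fun σ : Perm (Fin n) => σ j' < σ j) = 1 := by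
    unfold freq
    rw [← Finset.expect_add_distrib]
    have : ∀ σ : Perm (Fin n), ind (σ j < σ j') + ind (σ j' < σ j) = 1 := fun σ => by
      rw [← ind_add_ind_not (σ j < σ j')]
      congr 1
      apply ind_congr
      have : σ j ≠ σ j' := fun e => h (σ.injective e)
      rw [not_lt]
      exact ⟨le_of_lt, fun h => lt_of_le_of_ne h this.symm⟩
    simp [this]
  linarith

/-- The elements of `S` that `σ` ranks at least as high as `j`. -/
def upper (σ : Perm (Fin n)) (S : Finset (Fin n)) (j : Fin n) : Finset (Fin n) :=
  S.filter fun j' => σ j ≤ σ j'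

lemma mem_upper {σ : Perm (Fin n)} {S : Finset (Fin n)} {j j' : Fin n} :
    j' ∈ upper σ S j ↔ j' ∈ S ∧ σ j ≤ σ j' := by simp [upper]

lemma upper_ssubset {σ : Perm (Fin n)} {S : Finset (Fin n)} {j j' : Fin n} (hj' : j' ∈ S)
    (h : σ j' < σ j) : upper σ S j ⊂ upper σ S j' := by
  refine (Finset.ssubset_iff_of_subset fun a ha => ?_).2 ⟨j', ?_, ?_⟩
  · rw [mem_upper] at ha ⊢
    exact ⟨ha.1, h.le.trans ha.2⟩
  · simp [mem_upper, hj']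
  · simp [mem_upper, h]

/-- As `j` runs down the ranking of `S`, its upper sets grow strictly, so their sizes are `1, …,
S.card`, each once. -/
lemma sum_upper_card (σ : Perm (Fin n)) (S : Finset (Fin n)) (f : ℕ → ℝ) :
    ∑ j ∈ S, f (upper σ S j).card = ∑ l ∈ Finset.range S.card, f (l + 1) := by
  have hpos : ∀ j ∈ S, 0 < (upper σ S j).card := fun j hj =>
    Finset.card_pos.2 ⟨j, mem_upper.2 ⟨hj, le_rfl⟩⟩
  have hmaps : Set.MapsTo (fun j => (upper σ S j).card - 1) S (Finset.range S.card) := by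
    intro j hj
    have h1 := hpos j hj
    have h2 : (upper σ S j).card ≤ S.card := Finset.card_le_card (Finset.filter_subset _ _)
    simp only [Finset.coe_range, Set.mem_Iio]
    omega
  have hinj : Set.InjOn (fun j => (upper σ S j).card - 1) S := by
    intro j hj j' hj' h
    have h1 := hpos j hj
    have h2 := hpos j' hj'
    have h3 : (upper σ S j).card = (upper σ S j').card := by
      simp only at h; omega
    rcases lt_trichotomy (σ j) (σ j') with h | h | h
    · exact absurd h3 (Finset.card_lt_card (upper_ssubset hj h)).ne'
    · exact σ.injective h
    · exact absurd h3 (Finset.card_lt_card (upper_ssubset hj' h)).ne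
  refine Finset.sum_nbij (fun j => (upper σ S j).card - 1) hmaps hinj
    (Finset.surjOn_of_injOn_of_card_le _ hmaps hinj (by simp)) fun j hj => ?_
  have h1 := hpos j hj
  congr 1
  omega

/-- The rank of an element of `S` within `S` is uniform. -/
lemma expect_upper_card {S : Finset (Fin n)} {j : Fin n} (hj : j ∈ S) (f : ℕ → ℝ) :
    𝔼 σ : Perm (Fin n), f (upper σ S j).card =
      (∑ l ∈ Finset.range S.card, f (l + 1)) / S.card := by
  -- Swapping `j` and `j'` preserves the uniform law, so the average is the same for every element
  -- of `S`; the sum over `S` does not depend on `σ`.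
  have hsymm : ∀ j' ∈ S, 𝔼 σ : Perm (Fin n), f (upper σ S j').card =
      𝔼 σ : Perm (Fin n), f (upper σ S j).card := by
    intro j' hj'
    rw [← expect_perm_mul_right (swap j j')]
    refine Finset.expect_congr rfl fun σ _ => ?_
    congr 1
    refine Finset.card_bij' (fun a _ => swap j j' a) (fun a _ => swap j j' a) ?_ ?_ ?_ ?_
    · intro a ha
      rw [mem_upper] at ha ⊢
      refine ⟨?_, by simpa using ha.2⟩
      rw [swap_apply_def]; split_ifs <;> first | assumption | exact ha.1
    · intro a ha
      rw [mem_upper] at ha ⊢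
      refine ⟨?_, by simpa using ha.2⟩
      rw [swap_apply_def]; split_ifs <;> first | assumption | exact ha.1
    · simp
    · simp
  have hsum : ∑ j' ∈ S, 𝔼 σ : Perm (Fin n), f (upper σ S j').card =
      ∑ l ∈ Finset.range S.card, f (l + 1) := by
    rw [← Finset.expect_sum_comm]
    simp only [sum_upper_card]
    exact Fintype.expect_const _
  rw [Finset.sum_congr rfl hsymm, Finset.sum_const, nsmul_eq_mul] at hsum
  have : (S.card : ℝ) ≠ 0 := by
    exact_mod_cast (Finset.card_pos.2 ⟨j, hj⟩).ne'
  rw [← hsum]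
  field_simp

/-- `σ` ranks `j` top among `S`. -/
def IsTop (σ : Perm (Fin n)) (S : Finset (Fin n)) (j : Fin n) : Prop :=
  ∀ j' ∈ S, σ j' ≤ σ j

lemma sum_ind_isTop (σ : Perm (Fin n)) {S : Finset (Fin n)} (hS : S.Nonempty) :
    ∑ j ∈ S, ind (IsTop σ S j) = 1 := by
  obtain ⟨j, hj, htop⟩ := S.exists_max_image σ hS
  rw [Finset.sum_eq_single_of_mem j hj]
  · exact ind_true htop
  · intro j' hj' hne
    refine ind_false fun h => hne (σ.injective (le_antisymm (htop j' hj') (h j hj)))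

lemma expect_ind_isTop {S : Finset (Fin n)} {j : Fin n} (hj : j ∈ S) :
    𝔼 σ : Perm (Fin n), ind (IsTop σ S j) = 1 / S.card := by
  have h := expect_upper_card hj (fun l => ind (l = 1))
  have h1 : ∀ σ : Perm (Fin n), ind ((upper σ S j).card = 1) = ind (IsTop σ S j) := by
    intro σ
    apply ind_congr
    rw [Finset.card_eq_one]
    constructor
    · rintro ⟨a, ha⟩ j' hj'
      have hja : j = a := by
        rw [← Finset.mem_singleton, ← ha]; exact mem_upper.2 ⟨hj, le_rfl⟩
      by_contra hlt
      have : j' = a := by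
        rw [← Finset.mem_singleton, ← ha]; exact mem_upper.2 ⟨hj', (not_le.1 hlt).le⟩
      rw [this, hja] at hlt
      exact hlt le_rfl
    · intro ht
      refine ⟨j, Finset.ext fun a => ?_⟩
      rw [mem_upper, Finset.mem_singleton]
      constructor
      · rintro ⟨ha, hle⟩
        exact σ.injective (le_antisymm (ht a ha) hle)
      · rintro rfl
        exact ⟨hj, le_rfl⟩
  simp only [h1] at h
  rw [h]
  congr 1
  rw [Finset.sum_eq_single_of_mem 0]
  · exact ind_true rfl
  · exact Finset.mem_range.2 (Finset.card_pos.2 ⟨j, hj⟩)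
  · intro l _ hl
    exact ind_false (by simpa using hl)

/-- The tops of two nested sets are independent. -/
lemma expect_ind_isTop_mul {S T : Finset (Fin n)} (hST : S ⊆ T) {i j : Fin n} (hi : i ∈ S)
    (hj : j ∈ T) (hjS : j ∉ S) :
    𝔼 σ : Perm (Fin n), ind (IsTop σ S i) * ind (IsTop σ T j) =
      (1 / (S.card : ℝ)) * (1 / T.card) := by
  classical
  set c := 𝔼 σ : Perm (Fin n), ind (IsTop σ S i) * ind (IsTop σ T j) with hc
  -- Swapping two points of `T \ S` fixes `S` pointwise and maps `T` to itself, so all of them share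
  -- the value `c`.
  have hout : ∀ a ∈ T \ S, 𝔼 σ : Perm (Fin n), ind (IsTop σ S i) * ind (IsTop σ T a) = c := by
    intro a ha
    rw [Finset.mem_sdiff] at ha
    rw [hc, ← expect_perm_mul_right (swap a j)]
    refine Finset.expect_congr rfl fun σ _ => ?_
    have hfix : ∀ b ∈ S, swap a j b = b := fun b hb =>
      swap_apply_of_ne_of_ne (fun e => ha.2 (e ▸ hb)) (fun e => hjS (e ▸ hb))
    have hT : ∀ b ∈ T, swap a j b ∈ T := by
      intro b hb
      rw [swap_apply_def]; split_ifs <;> first | assumption | exact ha.1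
    congr 1
    · apply ind_congr
      unfold IsTop
      refine forall₂_congr fun b hb => ?_
      rw [Perm.mul_apply, Perm.mul_apply, hfix b hb, hfix i hi]
    · apply ind_congr
      unfold IsTop
      constructor
      · intro h b hb
        simpa using h _ (hT b hb)
      · intro h b hb
        simpa using h _ (hT b hb)
  -- If the top of `T` lies in `S`, it is also the top of `S`, so only `a = i` contributes. Summing
  -- over `T` then gives the linear equation `(|T| - |S|) c + 1/|T| = 1/|S|`.
  have hin : ∑ a ∈ S, 𝔼 σ : Perm (Fin n), ind (IsTop σ S i) * ind (IsTop σ T a) = 1 / T.card := by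
    rw [Finset.sum_eq_single_of_mem i hi, ← expect_ind_isTop (hST hi)]
    · refine Finset.expect_congr rfl fun σ _ => ?_
      rw [← ind_and]
      exact ind_congr ⟨fun h => h.2, fun h => ⟨fun b hb => h b (hST hb), h⟩⟩
    · intro a ha hne
      refine Finset.expect_eq_zero fun σ _ => ?_
      rw [← ind_and]
      exact ind_false fun h =>
        hne (σ.injective (le_antisymm (h.1 a ha) (h.2 i (hST hi))))
  have htot : ∑ a ∈ T, 𝔼 σ : Perm (Fin n), ind (IsTop σ S i) * ind (IsTop σ T a) =
      1 / S.card := by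
    rw [← Finset.expect_sum_comm, ← expect_ind_isTop hi]
    refine Finset.expect_congr rfl fun σ _ => ?_
    rw [← Finset.mul_sum, sum_ind_isTop σ ⟨j, hj⟩, mul_one]
  rw [← Finset.sum_sdiff hST, hin, Finset.sum_congr rfl hout, Finset.sum_const, nsmul_eq_mul,
    Finset.card_sdiff_of_subset hST, Nat.cast_sub (Finset.card_le_card hST)] at htot
  have hs : (0 : ℝ) < S.card := by exact_mod_cast Finset.card_pos.2 ⟨i, hi⟩
  have hst : (S.card : ℝ) < T.card := by
    exact_mod_cast Finset.card_lt_card ((Finset.ssubset_iff_of_subset hST).2 ⟨j, hj, hjS⟩)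
  have h3 : ((T.card : ℝ) - S.card) * c =
      (T.card - S.card) * ((1 / (S.card : ℝ)) * (1 / T.card)) := by
    have ht : (0 : ℝ) < T.card := hs.trans hst
    have : ((T.card : ℝ) - S.card) * c = 1 / S.card - 1 / T.card := by linarith
    rw [this]
    field_simp
  exact mul_left_cancel₀ (sub_ne_zero.2 hst.ne') h3

end perm

/-! ### Elimination stops when Row does not react -/

open Classical in
/-- The columns of `S` that no other column of `S` beats in every row. -/
def undominated (c : Fin m → Perm (Fin n)) (S : Finset (Fin n)) : Finset (Fin n) :=
  S.filter fun j => ¬ ∃ j' ∈ S, j' ≠ j ∧ ∀ i, c i j < c i j'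

lemma mem_undominated {c : Fin m → Perm (Fin n)} {S : Finset (Fin n)} {j : Fin n} :
    j ∈ undominated c S ↔ j ∈ S ∧ ¬ ∃ j' ∈ S, j' ≠ j ∧ ∀ i, c i j < c i j' := by
  simp [undominated]

/-- The number of columns that are not dominated in the full game. -/
def maxima (c : Fin m → Perm (Fin n)) : ℕ := (undominated c Finset.univ).card

lemma maxima_le (c : Fin m → Perm (Fin n)) : maxima c ≤ n :=
  (Finset.card_le_univ _).trans_eq (Fintype.card_fin n)

/-- Row has a dominated action against the columns that are undominated in the full game. -/
def RowReacts (g : Game m n) : Prop :=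
  ∃ i, RowDominated g Finset.univ (undominated g.2 Finset.univ) i

lemma RowDominated.mono {g : Game m n} {A : Finset (Fin m)} {B B' : Finset (Fin n)} {i : Fin m}
    (h : RowDominated g A B i) (hB : B' ⊆ B) : RowDominated g A B' i := by
  obtain ⟨i', hi', h⟩ := h
  exact ⟨i', hi', fun j hj => h j (hB hj)⟩

lemma remaining_succ (g : Game m n) (k : ℕ) :
    remaining g (k + 1) = eliminate g (remaining g k) :=
  Function.iterate_succ_apply' _ _ _

/-- A row is needed to exclude self-domination: with none, `ColDominated` would hold vacuously with
`j' = j`. -/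
lemma eliminate_univ_snd (hm : 0 < m) (g : Game m n) :
    (eliminate g (Finset.univ, Finset.univ)).2 = undominated g.2 Finset.univ := by
  ext j
  simp only [eliminate, Finset.mem_filter, mem_undominated, ColDominated, colPayoff,
    Finset.mem_univ, true_and, true_imp_iff]
  refine not_congr (exists_congr fun j' => ⟨fun h => ⟨?_, h⟩, fun h => h.2⟩)
  rintro rfl
  exact lt_irrefl _ (h ⟨0, hm⟩)

/-- Row domination only becomes easier when columns are removed, so its absence against the
undominated columns covers both choices of `B`. While all rows remain, an undominated column stays
undominated. -/
lemma eliminate_of_not_rowReacts (hm : 0 < m) {g : Game m n} (h : ¬ RowReacts g)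
    {B : Finset (Fin n)} (hB : B = Finset.univ ∨ B = undominated g.2 Finset.univ) :
    eliminate g (Finset.univ, B) = (Finset.univ, undominated g.2 Finset.univ) := by
  classical
  have hsub : undominated g.2 Finset.univ ⊆ B := by
    rcases hB with rfl | rfl
    · exact Finset.subset_univ _
    · exact subset_rfl
  refine Prod.ext ?_ ?_
  · refine Finset.filter_true_of_mem fun i _ hi => h ⟨i, ?_⟩
    exact hi.mono hsub
  · rcases hB with rfl | rfl
    · exact eliminate_univ_snd hm g
    · refine Finset.filter_true_of_mem fun j hj hd => ?_
      obtain ⟨j', -, hd⟩ := hd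
      refine (mem_undominated.1 hj).2 ⟨j', Finset.mem_univ _, ?_, fun i => hd i (Finset.mem_univ i)⟩
      rintro rfl
      exact lt_irrefl _ (hd ⟨0, hm⟩ (Finset.mem_univ _))

lemma remaining_of_not_rowReacts (hm : 0 < m) {g : Game m n} (h : ¬ RowReacts g) (k : ℕ) :
    remaining g (k + 1) = (Finset.univ, undominated g.2 Finset.univ) := by
  induction k with
  | zero =>
    rw [remaining_succ]
    exact eliminate_of_not_rowReacts hm h (Or.inl rfl)
  | succ k ih =>
    rw [remaining_succ, ih]
    exact eliminate_of_not_rowReacts hm h (Or.inr rfl)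

lemma survivingCol_le_maxima (hm : 0 < m) (g : Game m n) : survivingCol g ≤ maxima g.2 := by
  have : {j : Fin n | ∀ k, j ∈ (remaining g k).2} ⊆ undominated g.2 Finset.univ := by
    intro j hj
    have := hj 1
    rwa [remaining_succ, show remaining g 0 = (Finset.univ, Finset.univ) from rfl,
      eliminate_univ_snd hm] at this
  simpa [survivingCol, maxima] using Set.ncard_le_ncard this (Finset.finite_toSet _)

lemma survivingCol_of_not_rowReacts (hm : 0 < m) {g : Game m n} (h : ¬ RowReacts g) :
    survivingCol g = maxima g.2 := by
  have : {j : Fin n | ∀ k, j ∈ (remaining g k).2} = undominated g.2 Finset.univ := by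
    ext j
    constructor
    · intro hj
      simpa [remaining_of_not_rowReacts hm h 0] using hj 1
    · rintro hj (_ | k)
      · exact Finset.mem_univ j
      · rw [remaining_of_not_rowReacts hm h]; exact hj
  rw [survivingCol, this, Set.ncard_coe_finset, maxima]

lemma survivingRow_of_not_rowReacts (hm : 0 < m) {g : Game m n} (h : ¬ RowReacts g) :
    survivingRow g = m := by
  have : {i : Fin m | ∀ k, i ∈ (remaining g k).1} = Set.univ := by
    refine Set.eq_univ_of_forall fun i => ?_
    rintro (_ | k)
    · exact Finset.mem_univ i
    · rw [remaining_of_not_rowReacts hm h]; exact Finset.mem_univ i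
  rw [survivingRow, this, Set.ncard_univ, Nat.card_eq_fintype_card, Fintype.card_fin]

/-! ### Conditioning on Column's rankings -/

lemma prob_eq_freq (P : Game m n → Prop) : prob m n P = freq P := by
  classical
  rw [prob, freq, Fintype.expect_eq_sum_div_card, ← card_filter_eq_sum_ind]

lemma expect_eq_expect (X : Game m n → ℝ) : expect m n X = 𝔼 g, X g :=
  (Fintype.expect_eq_sum_div_card _).symm

lemma expect_game (X : Game m n → ℝ) :
    𝔼 g, X g = 𝔼 c : Fin m → Perm (Fin n), 𝔼 r : Fin n → Perm (Fin m), X (r, c) := by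
  rw [Finset.expect_comm, ← Finset.univ_product_univ, Finset.expect_product]

lemma expect_game_snd (X : (Fin m → Perm (Fin n)) → ℝ) :
    𝔼 g : Game m n, X g.2 = 𝔼 c, X c := by
  rw [expect_game]
  simp

/-- With `c` fixed, the undominated set is fixed and Row's rankings are independent across its
columns. A given pair of distinct actions is ordered one way with probability `1/2` in each; a union
bound runs over the `m²` pairs. -/
lemma freq_rowReacts_le (c : Fin m → Perm (Fin n)) :
    freq (fun r : Fin n → Perm (Fin m) => RowReacts (r, c)) ≤
      (m : ℝ) ^ 2 * (1 / 2) ^ maxima c := by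
  have hpair : ∀ i i' : Fin m, freq (fun r : Fin n → Perm (Fin m) =>
      ∀ j ∈ undominated c Finset.univ, r j i < r j i') ≤ (1 / 2) ^ maxima c := by
    intro i i'
    rw [freq_pi (fun j (σ : Perm (Fin m)) => j ∈ undominated c Finset.univ → σ i < σ i')]
    have hfac : ∀ j, freq (fun σ : Perm (Fin m) => j ∈ undominated c Finset.univ → σ i < σ i') ≤
        if j ∈ undominated c Finset.univ then 1 / 2 else 1 := by
      intro j
      split_ifs with hj
      · by_cases h : i = i'
        · subst h
          simp [hj, freq, ind]
        · simp only [hj, true_imp_iff]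
          exact (freq_perm_lt h).le
      · exact freq_le_one _
    refine (Finset.prod_le_prod (fun j _ => freq_nonneg _) fun j _ => hfac j).trans_eq ?_
    rw [Finset.prod_ite, Finset.prod_const, Finset.prod_const_one, mul_one]
    simp [maxima]
  calc freq (fun r : Fin n → Perm (Fin m) => RowReacts (r, c))
      ≤ 𝔼 r : Fin n → Perm (Fin m), ∑ i, ∑ i' : Fin m,
          ind (∀ j ∈ undominated c Finset.univ, r j i < r j i') := by
        refine expect_le_expect_of_le fun r => ?_
        refine (ind_exists_le_sum _).trans (Finset.sum_le_sum fun i _ => ?_)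
        refine (ind_mono ?_).trans (ind_exists_le_sum _)
        rintro ⟨i', -, h⟩
        exact ⟨i', h⟩
    _ = ∑ i, ∑ i' : Fin m, freq (fun r : Fin n → Perm (Fin m) =>
          ∀ j ∈ undominated c Finset.univ, r j i < r j i') := by
        simp only [Finset.expect_sum_comm, freq]
    _ ≤ ∑ i : Fin m, ∑ i' : Fin m, (1 / 2) ^ maxima c :=
        Finset.sum_le_sum fun i _ => Finset.sum_le_sum fun i' _ => hpair i i'
    _ = _ := by simp; ring

lemma half_pow_le {K : ℝ} {k : ℕ} (h : K ≤ k) : (1 / 2 : ℝ) ^ k ≤ 2 ^ (-K) := by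
  rw [one_div, inv_pow, ← Real.rpow_natCast, ← Real.rpow_neg zero_le_two]
  exact Real.rpow_le_rpow_of_exponent_le one_le_two (neg_le_neg h)

lemma prob_rowReacts_le (K : ℝ) :
    prob m n RowReacts ≤ (m : ℝ) ^ 2 * 2 ^ (-K) +
      freq (fun c : Fin m → Perm (Fin n) => (maxima c : ℝ) < K) := by
  rw [prob_eq_freq, freq, expect_game]
  have hc : (m : ℝ) ^ 2 * 2 ^ (-K) =
      𝔼 _c : Fin m → Perm (Fin n), (m : ℝ) ^ 2 * (2 : ℝ) ^ (-K) := by simp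
  rw [hc, freq, ← Finset.expect_add_distrib]
  refine expect_le_expect_of_le fun c => ?_
  have hpos : (0 : ℝ) ≤ (m : ℝ) ^ 2 * 2 ^ (-K) := by positivity
  by_cases h : (maxima c : ℝ) < K
  · rw [ind_true h]
    have := freq_le_one (fun r : Fin n → Perm (Fin m) => RowReacts (r, c))
    rw [freq] at this
    linarith
  · have := freq_rowReacts_le c
    rw [freq] at this
    have h2 : (m : ℝ) ^ 2 * (1 / 2) ^ maxima c ≤ (m : ℝ) ^ 2 * 2 ^ (-K) := by
      gcongr
      exact half_pow_le (not_lt.1 h)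
    linarith [ind_nonneg ((maxima c : ℝ) < K)]

lemma meanSurvivingCol_le (hm : 0 < m) :
    meanSurvivingCol m n ≤ 𝔼 c : Fin m → Perm (Fin n), (maxima c : ℝ) := by
  rw [meanSurvivingCol, expect_eq_expect, ← expect_game_snd]
  exact expect_le_expect_of_le fun g => Nat.cast_le.2 (survivingCol_le_maxima hm g)

/-- The difference vanishes unless Row reacts and is at most `maxima`. Where `maxima < K` it is
below `K`; elsewhere the conditional probability of a reaction is at most `m² 2 ^ (-K)`. -/
lemma expect_maxima_sub_meanSurvivingCol_le (hm : 0 < m) (K : ℝ) :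
    (𝔼 c : Fin m → Perm (Fin n), (maxima c : ℝ)) - meanSurvivingCol m n ≤
      (m : ℝ) ^ 2 * 2 ^ (-K) * (𝔼 c : Fin m → Perm (Fin n), (maxima c : ℝ)) +
      K * freq (fun c : Fin m → Perm (Fin n) => (maxima c : ℝ) < K) := by
  rw [meanSurvivingCol, expect_eq_expect, ← expect_game_snd, ← Finset.expect_sub_distrib,
    expect_game_snd (fun c => (maxima c : ℝ)), freq, Finset.mul_expect, Finset.mul_expect,
    ← Finset.expect_add_distrib]
  have h1 : ∀ g : Game m n, (maxima g.2 : ℝ) - survivingCol g ≤ maxima g.2 * ind (RowReacts g) := by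
    intro g
    by_cases h : RowReacts g
    · rw [ind_true h]
      linarith [(Nat.cast_nonneg (survivingCol g) : (0 : ℝ) ≤ _)]
    · rw [ind_false h, survivingCol_of_not_rowReacts hm h]
      simp
  refine (expect_le_expect_of_le h1).trans ?_
  rw [expect_game]
  refine expect_le_expect_of_le fun c => ?_
  simp only
  rw [← Finset.mul_expect]
  have hM : (0 : ℝ) ≤ maxima c := Nat.cast_nonneg _
  by_cases h : (maxima c : ℝ) < K
  · have h3 := freq_le_one (fun r : Fin n → Perm (Fin m) => RowReacts (r, c))
    rw [freq] at h3
    have h4 := mul_le_mul_of_nonneg_left h3 hM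
    have h5 : (0 : ℝ) ≤ (m : ℝ) ^ 2 * 2 ^ (-K) * maxima c := by positivity
    rw [ind_true h]
    linarith
  · have h3 := freq_rowReacts_le c
    rw [freq] at h3
    have h2 : (m : ℝ) ^ 2 * (1 / 2) ^ maxima c ≤ (m : ℝ) ^ 2 * 2 ^ (-K) := by
      gcongr
      exact half_pow_le (not_lt.1 h)
    have h4 := mul_le_mul_of_nonneg_left (h3.trans h2) hM
    rw [ind_false h]
    linarith

/-! ### Few dominated columns when Row has many actions -/

/-- Columns are rarely dominated when Row has many actions. -/
lemma expect_sub_maxima_le :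
    𝔼 c : Fin m → Perm (Fin n), ((n : ℝ) - maxima c) ≤ (n : ℝ) ^ 2 * (1 / 2) ^ m := by
  have h1 : ∀ c : Fin m → Perm (Fin n), (n : ℝ) - maxima c ≤
      ∑ j : Fin n, ∑ j' : Fin n, ind (j' ≠ j ∧ ∀ i, c i j < c i j') := by
    intro c
    have : (n : ℝ) = ∑ j : Fin n, (1 : ℝ) := by simp
    rw [maxima, undominated, card_filter_eq_sum_ind, this, ← Finset.sum_sub_distrib]
    refine Finset.sum_le_sum fun j _ => ?_
    rw [← ind_add_ind_not (∃ j' ∈ Finset.univ, j' ≠ j ∧ ∀ i, c i j < c i j'), add_sub_cancel_right]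
    refine (ind_mono ?_).trans (ind_exists_le_sum _)
    rintro ⟨j', -, h⟩
    exact ⟨j', h⟩
  refine (expect_le_expect_of_le h1).trans ?_
  simp only [Finset.expect_sum_comm]
  have h2 : ∀ j j' : Fin n, 𝔼 c : Fin m → Perm (Fin n), ind (j' ≠ j ∧ ∀ i, c i j < c i j') ≤
      (1 / 2) ^ m := by
    intro j j'
    by_cases h : j' = j
    · simp [h, ind]
    · simp only [ne_eq, h, not_false_eq_true, true_and]
      have := freq_pi (fun (_ : Fin m) (σ : Perm (Fin n)) => σ j < σ j')
      rw [freq] at this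
      rw [this]
      simp [freq_perm_lt (Ne.symm h)]
  calc _ ≤ ∑ j : Fin n, ∑ j' : Fin n, ((1 / 2) ^ m : ℝ) :=
        Finset.sum_le_sum fun j _ => Finset.sum_le_sum fun j' _ => h2 j j'
    _ = _ := by simp; ring

lemma le_expect_maxima :
    (n : ℝ) - (n : ℝ) ^ 2 * (1 / 2) ^ m ≤ 𝔼 c : Fin m → Perm (Fin n), (maxima c : ℝ) := by
  have h := expect_sub_maxima_le (m := m) (n := n)
  rw [Finset.expect_sub_distrib, Fintype.expect_const] at h
  linarith

/-- Markov's inequality for the number `n - maxima c` of dominated columns. -/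
lemma freq_maxima_lt_half (hn : 0 < n) :
    freq (fun c : Fin m → Perm (Fin n) => (maxima c : ℝ) < n / 2) ≤
      2 * n * (1 / 2) ^ m := by
  have h := mul_freq_le_expect (f := fun c : Fin m → Perm (Fin n) => (n : ℝ) - maxima c)
    (fun c => sub_nonneg.2 (Nat.cast_le.2 (maxima_le c))) (n / 2)
    (P := fun c => (maxima c : ℝ) < n / 2) (fun c hc => by linarith)
  have h2 := h.trans expect_sub_maxima_le
  have hn' : (0 : ℝ) < n := Nat.cast_pos.2 hn
  have h3 : (n : ℝ) / 2 * freq (fun c : Fin m → Perm (Fin n) => (maxima c : ℝ) < n / 2) ≤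
      n / 2 * (2 * n * (1 / 2) ^ m) := by
    refine h2.trans_eq ?_
    ring
  exact le_of_mul_le_mul_left h3 (by positivity)

/-! ### The exact mean number of undominated columns -/

/-- The complete homogeneous symmetric polynomial of degree `k` in `1, 1/2, …, 1/n`. -/
def hsum : ℕ → ℕ → ℝ
  | 0, _ => 1
  | k + 1, n => ∑ l ∈ Finset.range n, hsum k (l + 1) / (l + 1)

/-- The probability that a given element of a set of `s` elements is undominated in it, with
respect to `m` random rankings. -/
def undomProb : ℕ → ℕ → ℝ
  | 0, s => ind (s = 1)
  | m + 1, s => (∑ l ∈ Finset.range s, undomProb m (l + 1)) / s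

/-- Condition on the first ranking: only the columns it puts above `j` can still dominate `j`, and
the size of this upper set is uniform. With no ranking left, any other column dominates vacuously,
whence the base case `s = 1`. -/
lemma freq_mem_undominated {S : Finset (Fin n)} {j : Fin n} (hj : j ∈ S) :
    freq (fun c : Fin m → Perm (Fin n) => j ∈ undominated c S) = undomProb m S.card := by
  induction m generalizing S with
  | zero =>
    rw [undomProb, freq, Fintype.expect_eq_sum_div_card]
    simp only [Fintype.card_unique, Nat.cast_one, div_one, Finset.univ_unique,
      Finset.sum_singleton]
    apply ind_congr
    rw [mem_undominated, Finset.card_eq_one]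
    constructor
    · rintro ⟨-, h⟩
      refine ⟨j, Finset.eq_singleton_iff_unique_mem.2 ⟨hj, fun x hx => ?_⟩⟩
      by_contra hne
      exact h ⟨x, hx, hne, fun i => i.elim0⟩
    · rintro ⟨a, rfl⟩
      refine ⟨hj, ?_⟩
      rintro ⟨j', hj', hne, -⟩
      rw [Finset.mem_singleton] at hj hj'
      exact hne (hj'.trans hj.symm)
  | succ m ih =>
    rw [freq, expect_pi_succ, undomProb, ← expect_upper_card hj]
    refine Finset.expect_congr rfl fun σ _ => ?_
    have hj' : j ∈ upper σ S j := mem_upper.2 ⟨hj, le_rfl⟩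
    rw [← ih hj', freq]
    refine Finset.expect_congr rfl fun c _ => ind_congr ?_
    rw [mem_undominated, mem_undominated]
    refine and_congr (by simp [hj, hj']) (not_congr (exists_congr fun j' => ?_))
    simp only [mem_upper, Fin.forall_fin_succ, Fin.cons_zero, Fin.cons_succ]
    constructor
    · rintro ⟨h1, h2, h3, h4⟩
      exact ⟨⟨h1, h3.le⟩, h2, h4⟩
    · rintro ⟨⟨h1, h3⟩, h2, h4⟩
      exact ⟨h1, h2, lt_of_le_of_ne h3 fun e => h2 (σ.injective e).symm, h4⟩

lemma mul_undomProb_succ (k s : ℕ) (hs : 0 < s) : (s : ℝ) * undomProb (k + 1) s = hsum k s := by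
  induction k generalizing s with
  | zero =>
    have : (s : ℝ) ≠ 0 := by exact_mod_cast hs.ne'
    rw [undomProb, mul_div_cancel₀ _ this, hsum, Finset.sum_eq_single_of_mem 0]
    · exact ind_true rfl
    · exact Finset.mem_range.2 hs
    · intro l _ hl
      exact ind_false (by simpa using hl)
  | succ k ih =>
    have : (s : ℝ) ≠ 0 := by exact_mod_cast hs.ne'
    rw [undomProb, mul_div_cancel₀ _ this, hsum]
    refine Finset.sum_congr rfl fun l _ => ?_
    have h := ih (l + 1) l.succ_pos
    push_cast at h
    rw [← h]
    field_simp

lemma expect_maxima_eq_hsum (k : ℕ) (hn : 0 < n) :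
    𝔼 c : Fin (k + 1) → Perm (Fin n), (maxima c : ℝ) = hsum k n := by
  have h : ∀ c : Fin (k + 1) → Perm (Fin n), (maxima c : ℝ) =
      ∑ j, ind (j ∈ undominated c Finset.univ) := by
    intro c
    rw [maxima, ← Finset.filter_univ_mem (undominated c Finset.univ), card_filter_eq_sum_ind]
    simp
  simp only [h, Finset.expect_sum_comm]
  have h2 := fun j : Fin n => freq_mem_undominated (m := k + 1) (Finset.mem_univ j)
  simp only [freq] at h2
  simp [h2, mul_undomProb_succ k n hn]

/-! ### Newton's identity and estimates of `hsum` -/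

/-- Power sums of `1, 1/2, …, 1/n`. -/
def psum (r n : ℕ) : ℝ := ∑ l ∈ Finset.range n, (1 / ((l : ℝ) + 1)) ^ r

lemma psum_succ (r n : ℕ) : psum r (n + 1) = psum r n + (1 / ((n : ℝ) + 1)) ^ r :=
  Finset.sum_range_succ _ _

lemma hsum_succ_succ (k n : ℕ) :
    hsum (k + 1) (n + 1) = hsum (k + 1) n + 1 / ((n : ℝ) + 1) * hsum k (n + 1) := by
  rw [hsum, hsum, Finset.sum_range_succ]
  ring

lemma hsum_nonneg (k n : ℕ) : 0 ≤ hsum k n := by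
  induction k generalizing n with
  | zero => exact zero_le_one
  | succ k ih => exact Finset.sum_nonneg fun l _ => div_nonneg (ih _) (by positivity)

lemma psum_nonneg (r n : ℕ) : 0 ≤ psum r n := Finset.sum_nonneg fun l _ => by positivity

/-- Newton's identity. -/
lemma sum_psum_mul_hsum (k n : ℕ) :
    ∑ r ∈ Finset.range k, psum (r + 1) n * hsum (k - 1 - r) n = k * hsum k n := by
  induction n generalizing k with
  | zero =>
    rcases k with _ | k
    · simp
    · simp [hsum, psum]
  | succ n ihn =>
    induction k with
    | zero => simp
    | succ k ihk =>
      set x : ℝ := 1 / ((n : ℝ) + 1) with hx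
      -- The new variable `x` is separated from the power sums here and from `hsum` in `e2`; the
      -- inner induction on `k` enters through `e3`. The sums of powers of `x` in `e3` and `e4` then
      -- cancel.
      have e1 : ∑ r ∈ Finset.range (k + 1), psum (r + 1) (n + 1) * hsum (k - r) (n + 1) =
          ∑ r ∈ Finset.range (k + 1), psum (r + 1) n * hsum (k - r) (n + 1) +
          ∑ r ∈ Finset.range (k + 1), x ^ (r + 1) * hsum (k - r) (n + 1) := by
        rw [← Finset.sum_add_distrib]
        refine Finset.sum_congr rfl fun r _ => ?_
        rw [psum_succ]; ring
      have e2 : ∑ r ∈ Finset.range (k + 1), psum (r + 1) n * hsum (k - r) (n + 1) =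
          ∑ r ∈ Finset.range (k + 1), psum (r + 1) n * hsum (k - r) n +
          x * ∑ r ∈ Finset.range k, psum (r + 1) n * hsum (k - 1 - r) (n + 1) := by
        rw [Finset.sum_range_succ, Finset.sum_range_succ _ k, Finset.mul_sum, Nat.sub_self]
        have : ∀ r ∈ Finset.range k, psum (r + 1) n * hsum (k - r) (n + 1) =
            psum (r + 1) n * hsum (k - r) n +
              x * (psum (r + 1) n * hsum (k - 1 - r) (n + 1)) := by
          intro r hr
          rw [Finset.mem_range] at hr
          rw [show k - r = (k - 1 - r) + 1 by omega, hsum_succ_succ]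
          ring
        rw [Finset.sum_congr rfl this, Finset.sum_add_distrib, hsum, hsum]
        ring
      have e3 : ∑ r ∈ Finset.range k, psum (r + 1) n * hsum (k - 1 - r) (n + 1) =
          k * hsum k (n + 1) -
          ∑ r ∈ Finset.range k, x ^ (r + 1) * hsum (k - 1 - r) (n + 1) := by
        rw [← ihk, ← Finset.sum_sub_distrib]
        refine Finset.sum_congr rfl fun r _ => ?_
        rw [psum_succ]; ring
      have e4 : ∑ r ∈ Finset.range (k + 1), x ^ (r + 1) * hsum (k - r) (n + 1) =
          x * ∑ r ∈ Finset.range k, x ^ (r + 1) * hsum (k - 1 - r) (n + 1) +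
          x * hsum k (n + 1) := by
        rw [Finset.sum_range_succ', Finset.mul_sum]
        congr 1
        · refine Finset.sum_congr rfl fun r _ => ?_
          rw [show k - (r + 1) = k - 1 - r by omega]
          ring
        · simp
      have e5 := ihn (k + 1)
      simp only [Nat.add_sub_cancel] at e5 ⊢
      rw [e1, e2, e3, e4, e5, hsum_succ_succ]
      push_cast
      ring

/-- The `n`-th harmonic number. -/
abbrev har (n : ℕ) : ℝ := psum 1 n

/-- Newton's identity for `k + 1` with only the term `r = 0` kept; all terms are nonnegative. -/
lemma har_mul_hsum_le (k n : ℕ) : har n * hsum k n ≤ (k + 1) * hsum (k + 1) n := by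
  have h := sum_psum_mul_hsum (k + 1) n
  push_cast at h
  rw [← h]
  refine (le_of_eq ?_).trans (Finset.single_le_sum (f := fun r =>
    psum (r + 1) n * hsum (k + 1 - 1 - r) n)
    (fun r _ => mul_nonneg (psum_nonneg _ _) (hsum_nonneg _ _)) (Finset.mem_range.2 k.succ_pos))
  simp

lemma har_pow_div_factorial_le (k n : ℕ) : har n ^ k / k.factorial ≤ hsum k n := by
  induction k with
  | zero => simp [hsum]
  | succ k ih =>
    have h := har_mul_hsum_le k n
    have h2 : har n * (har n ^ k / k.factorial) ≤ har n * hsum k n :=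
      mul_le_mul_of_nonneg_left ih (psum_nonneg _ _)
    have hk : (0 : ℝ) < k + 1 := by positivity
    rw [Nat.factorial_succ]
    push_cast
    have h3 : har n ^ (k + 1) / ((k + 1) * (k.factorial : ℝ)) =
        har n * (har n ^ k / k.factorial) / (k + 1) := by
      have : (k.factorial : ℝ) ≠ 0 := by exact_mod_cast k.factorial_ne_zero
      field_simp
      ring
    rw [h3, div_le_iff₀ hk]
    linarith

lemma psum_add_two_le (r n : ℕ) : psum (r + 2) n ≤ 2 := by
  -- Telescoping: each new square is at most the difference of consecutive reciprocals.
  have h : ∀ n : ℕ, psum 2 (n + 1) ≤ 2 - 1 / (n + 1) := by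
    intro n
    induction n with
    | zero => norm_num [psum]
    | succ n ih =>
      rw [psum_succ]
      have h1 : (1 / (((n + 1 : ℕ) : ℝ) + 1)) ^ 2 ≤ 1 / (n + 1 : ℝ) - 1 / ((n + 1 : ℕ) + 1 : ℝ) := by
        push_cast
        rw [div_pow, one_pow, div_sub_div _ _ (by positivity) (by positivity),
          div_le_div_iff₀ (by positivity) (by positivity)]
        have : (0 : ℝ) ≤ n := Nat.cast_nonneg n
        nlinarith
      linarith
  have h2 : psum (r + 2) n ≤ psum 2 n := by
    refine Finset.sum_le_sum fun l _ => ?_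
    refine pow_le_pow_of_le_one (by positivity) ?_ (by omega)
    rw [div_le_one (by positivity)]
    have : (0 : ℝ) ≤ l := Nat.cast_nonneg l
    linarith
  refine h2.trans ?_
  rcases n with _ | n
  · simp [psum]
  · have h3 : (0 : ℝ) ≤ 1 / (n + 1) := by positivity
    linarith [h n]

/-- In Newton's identity the term `r = 0` is the main one. By `har_mul_hsum_le`, lowering the degree
by one costs a factor `x = K / har n ≤ 1/2`, so the other terms form a geometric tail of at most `4
x * hsum k n`. The bound `K` stays fixed during the induction on `k`. -/
lemma hsum_le_mul_pow {K : ℝ} {n : ℕ} (hH : 0 < har n) (hK0 : 0 ≤ K) (hK : K ≤ har n / 2) (k : ℕ)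
    (hk : k ≤ K) :
    hsum k n ≤ har n ^ k / k.factorial * (1 + 4 * K / har n ^ 2) ^ k := by
  set x := K / har n with hx
  have hx0 : 0 ≤ x := by positivity
  have hx1 : x ≤ 1 / 2 := by rw [hx, div_le_iff₀ hH]; linarith
  have hstep : ∀ i : ℕ, ((i + 1 : ℕ) : ℝ) ≤ K → hsum i n ≤ x * hsum (i + 1) n := by
    intro i hi
    rw [hx, div_mul_eq_mul_div, le_div_iff₀ hH, mul_comm]
    refine (har_mul_hsum_le i n).trans ?_
    push_cast at hi
    exact mul_le_mul_of_nonneg_right hi (hsum_nonneg _ _)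
  have hsteps : ∀ r i : ℕ, ((i + r : ℕ) : ℝ) ≤ K → hsum i n ≤ x ^ r * hsum (i + r) n := by
    intro r
    induction r with
    | zero => intro i _; simp
    | succ r ih =>
      intro i hi
      refine (ih i (le_trans (by push_cast; linarith) hi)).trans ?_
      rw [pow_succ, mul_assoc]
      exact mul_le_mul_of_nonneg_left (hstep (i + r) hi) (by positivity)
  have hgeom : ∀ k : ℕ, ∑ r ∈ Finset.range k, x ^ (r + 1) ≤ 2 * x := by
    intro k
    have h1 := mul_neg_geom_sum x k
    have h2 : 0 ≤ x ^ k := by positivity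
    have h3 : 0 ≤ ∑ r ∈ Finset.range k, x ^ r := Finset.sum_nonneg fun r _ => by positivity
    have h4 : ∑ r ∈ Finset.range k, x ^ r ≤ 2 := by nlinarith
    simp only [pow_succ', ← Finset.mul_sum]
    nlinarith
  induction k with
  | zero => simp [hsum]
  | succ k ih =>
    have hk' : (k : ℝ) ≤ K := le_trans (by push_cast; linarith) hk
    have h := sum_psum_mul_hsum (k + 1) n
    rw [Finset.sum_range_succ', Nat.add_sub_cancel, Nat.sub_zero] at h
    have hrest : ∑ r ∈ Finset.range k, psum (r + 1 + 1) n * hsum (k - (r + 1)) n ≤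
        4 * x * hsum k n := by
      calc _ ≤ ∑ r ∈ Finset.range k, 2 * (x ^ (r + 1) * hsum k n) := by
            refine Finset.sum_le_sum fun r hr => ?_
            rw [Finset.mem_range] at hr
            have e : k - (r + 1) + (r + 1) = k := by omega
            have h1 := hsteps (r + 1) (k - (r + 1)) (by rw [e]; exact hk')
            rw [e] at h1
            exact mul_le_mul (psum_add_two_le r n) h1 (hsum_nonneg _ _) zero_le_two
        _ = 2 * (∑ r ∈ Finset.range k, x ^ (r + 1)) * hsum k n := by
            rw [← Finset.mul_sum, ← Finset.sum_mul]; ring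
        _ ≤ _ := by
            refine mul_le_mul_of_nonneg_right ?_ (hsum_nonneg _ _)
            linarith [hgeom k]
    have h2 : (k + 1 : ℝ) * hsum (k + 1) n ≤
        har n * (1 + 4 * K / har n ^ 2) *
          (har n ^ k / k.factorial * (1 + 4 * K / har n ^ 2) ^ k) := by
      refine le_trans ?_ (mul_le_mul_of_nonneg_left (ih hk') (by positivity))
      have e : har n * (1 + 4 * K / har n ^ 2) = har n + 4 * x := by
        rw [hx]; field_simp
      rw [e]
      push_cast at h
      linarith
    have hk1 : (0 : ℝ) < k + 1 := by positivity
    rw [Nat.factorial_succ]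
    push_cast
    have h3 : har n ^ (k + 1) / ((k + 1) * (k.factorial : ℝ)) * (1 + 4 * K / har n ^ 2) ^ (k + 1) =
        har n * (1 + 4 * K / har n ^ 2) *
          (har n ^ k / k.factorial * (1 + 4 * K / har n ^ 2) ^ k) / (k + 1) := by
      rw [pow_succ, pow_succ (1 + 4 * K / har n ^ 2), mul_comm ((k : ℝ) + 1), ← div_div]
      ring
    rw [h3, le_div_iff₀ hk1]
    linarith

lemma hsum_le {k n : ℕ} (hH : 0 < har n) (hk : (k : ℝ) ≤ har n / 2) :
    hsum k n ≤ har n ^ k / k.factorial * Real.exp (4 * (k / har n) ^ 2) := by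
  refine (hsum_le_mul_pow hH (Nat.cast_nonneg k) hk k le_rfl).trans ?_
  refine mul_le_mul_of_nonneg_left ?_ (by positivity)
  have h : (1 + 4 * (k : ℝ) / har n ^ 2) ^ k ≤ Real.exp (4 * k / har n ^ 2) ^ k := by
    refine pow_le_pow_left₀ (by positivity) ?_ k
    rw [add_comm]
    exact Real.add_one_le_exp _
  refine h.trans_eq ?_
  rw [← Real.exp_nat_mul]
  congr 1
  ring

lemma har_eq_harmonic (n : ℕ) : har n = (harmonic n : ℝ) := by
  simp [har, psum, harmonic]

lemma log_le_har (n : ℕ) : Real.log n ≤ har n := by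
  rw [har_eq_harmonic]
  rcases n with _ | n
  · simp
  · refine le_trans ?_ (log_add_one_le_harmonic (n + 1))
    apply Real.log_le_log (by positivity)
    push_cast; linarith

lemma har_le (n : ℕ) : har n ≤ 1 + Real.log n := by
  rw [har_eq_harmonic]
  exact harmonic_le_one_add_log n

/-! ### Records of two rankings -/

/-- The number of elements that `τ` ranks top among those that `σ` does not rank below them. -/
def records (σ τ : Perm (Fin n)) : ℝ := ∑ j, ind (IsTop τ (upper σ Finset.univ j) j)

/-- A dominating column would beat `j` in ranking `0`, hence lie in its upper set, and beat it in
ranking `1` too, where `j` is top of that set. -/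
lemma records_le_maxima {k : ℕ} (c : Fin (k + 2) → Perm (Fin n)) :
    records (c 0) (c 1) ≤ maxima c := by
  classical
  rw [records, ← card_filter_eq_sum_ind, maxima]
  refine Nat.cast_le.2 (Finset.card_le_card fun j hj => ?_)
  rw [Finset.mem_filter] at hj
  refine mem_undominated.2 ⟨Finset.mem_univ j, ?_⟩
  rintro ⟨j', -, -, h⟩
  exact absurd (hj.2 j' (mem_upper.2 ⟨Finset.mem_univ _, (h 0).le⟩)) (not_le.2 (h 1))

lemma mem_upper_self (σ : Perm (Fin n)) (j : Fin n) : j ∈ upper σ Finset.univ j :=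
  mem_upper.2 ⟨Finset.mem_univ j, le_rfl⟩

lemma sum_one_div_upper_card (σ : Perm (Fin n)) :
    ∑ j, 1 / ((upper σ Finset.univ j).card : ℝ) = har n := by
  rw [sum_upper_card σ Finset.univ (fun l => 1 / (l : ℝ))]
  simp [har, psum]

lemma expect_records (σ : Perm (Fin n)) : 𝔼 τ, records σ τ = har n := by
  simp only [records, Finset.expect_sum_comm]
  rw [← sum_one_div_upper_card σ]
  exact Finset.sum_congr rfl fun j _ => expect_ind_isTop (mem_upper_self σ j)

/-- The upper sets of `σ` are nested, so `expect_ind_isTop_mul` makes the record indicators pairwise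
independent. -/
lemma expect_ind_isTop_upper_mul (σ : Perm (Fin n)) {i j : Fin n} (h : i ≠ j) :
    𝔼 τ : Perm (Fin n), ind (IsTop τ (upper σ Finset.univ i) i) *
      ind (IsTop τ (upper σ Finset.univ j) j) =
      (1 / ((upper σ Finset.univ i).card : ℝ)) * (1 / (upper σ Finset.univ j).card) := by
  have main : ∀ {i j : Fin n}, σ j < σ i → 𝔼 τ : Perm (Fin n),
      ind (IsTop τ (upper σ Finset.univ i) i) * ind (IsTop τ (upper σ Finset.univ j) j) =
      (1 / ((upper σ Finset.univ i).card : ℝ)) * (1 / (upper σ Finset.univ j).card) := by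
    intro i j hij
    refine expect_ind_isTop_mul (upper_ssubset (Finset.mem_univ _) hij).1 (mem_upper_self σ i)
      (mem_upper_self σ j) fun hj => ?_
    exact absurd (mem_upper.1 hj).2 (not_le.2 hij)
  rcases lt_trichotomy (σ i) (σ j) with h' | h' | h'
  · rw [mul_comm, ← main h']
    exact Finset.expect_congr rfl fun τ _ => mul_comm _ _
  · exact absurd (σ.injective h') h
  · exact main h'

lemma expect_records_sq_le (σ : Perm (Fin n)) :
    𝔼 τ, records σ τ ^ 2 ≤ har n + har n ^ 2 := by
  have h1 : 𝔼 τ, records σ τ ^ 2 = ∑ i, ∑ j, 𝔼 τ : Perm (Fin n),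
      ind (IsTop τ (upper σ Finset.univ i) i) * ind (IsTop τ (upper σ Finset.univ j) j) := by
    simp only [records, sq, Finset.sum_mul_sum, Finset.expect_sum_comm]
  have h2 : har n + har n ^ 2 = ∑ i, ∑ j : Fin n,
      ((if i = j then 1 / ((upper σ Finset.univ i).card : ℝ) else 0) +
        (1 / ((upper σ Finset.univ i).card : ℝ)) * (1 / (upper σ Finset.univ j).card)) := by
    simp only [Finset.sum_add_distrib, Finset.sum_ite_eq, Finset.mem_univ, if_true]
    rw [← Finset.sum_mul_sum, sum_one_div_upper_card, sq]
  rw [h1, h2]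
  refine Finset.sum_le_sum fun i _ => Finset.sum_le_sum fun j _ => ?_
  split_ifs with h
  · subst h
    have : 𝔼 τ : Perm (Fin n), ind (IsTop τ (upper σ Finset.univ i) i) *
        ind (IsTop τ (upper σ Finset.univ i) i) = 1 / ((upper σ Finset.univ i).card : ℝ) := by
      simp only [← ind_and, and_self]
      exact expect_ind_isTop (mem_upper_self σ i)
    rw [this]
    have : (0 : ℝ) ≤ 1 / ((upper σ Finset.univ i).card : ℝ) *
      (1 / ((upper σ Finset.univ i).card : ℝ)) := by positivity
    linarith
  · rw [expect_ind_isTop_upper_mul σ h, zero_add]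

/-- Chebyshev's inequality for the number of records. -/
lemma freq_records_lt_le (σ : Perm (Fin n)) (hH : 0 < har n) :
    freq (fun τ : Perm (Fin n) => records σ τ < har n / 2) ≤ 4 / har n := by
  have hvar : 𝔼 τ, (records σ τ - har n) ^ 2 ≤ har n := by
    have e : ∀ τ, (records σ τ - har n) ^ 2 =
        records σ τ ^ 2 - 2 * har n * records σ τ + har n ^ 2 := fun τ => by ring
    simp only [e]
    rw [Finset.expect_add_distrib, Finset.expect_sub_distrib, ← Finset.mul_expect,
      expect_records, Fintype.expect_const]
    linarith [expect_records_sq_le σ]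
  -- Fewer than `har n / 2` records means a squared deviation of at least `(har n / 2) ^ 2`, while
  -- the variance is at most `har n`.
  have h := (mul_freq_le_expect (fun τ => sq_nonneg (records σ τ - har n)) ((har n / 2) ^ 2)
    (P := fun τ => records σ τ < har n / 2) fun τ hτ => by nlinarith).trans hvar
  rw [le_div_iff₀ hH]
  have h2 : har n * (freq (fun τ : Perm (Fin n) => records σ τ < har n / 2) * har n) ≤
      har n * 4 := by linarith
  exact le_of_mul_le_mul_left h2 hH

lemma expect_pi_two {α : Type*} [Fintype α] [Nonempty α] {k : ℕ} (F : α → α → ℝ) :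
    𝔼 c : Fin (k + 2) → α, F (c 0) (c 1) = 𝔼 a, 𝔼 b, F a b := by
  rw [expect_pi_succ]
  refine Finset.expect_congr rfl fun a _ => ?_
  rw [expect_pi_succ]
  refine Finset.expect_congr rfl fun b _ => ?_
  exact Fintype.expect_const (F a b)

lemma freq_maxima_lt_har (hm : 2 ≤ m) (hH : 0 < har n) :
    freq (fun c : Fin m → Perm (Fin n) => (maxima c : ℝ) < har n / 2) ≤ 4 / har n := by
  obtain ⟨k, rfl⟩ := Nat.exists_eq_add_of_le' hm
  calc _ ≤ freq (fun c : Fin (k + 2) → Perm (Fin n) => records (c 0) (c 1) < har n / 2) :=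
        freq_mono fun c hc => (records_le_maxima c).trans_lt hc
    _ = 𝔼 σ : Perm (Fin n), freq (fun τ : Perm (Fin n) => records σ τ < har n / 2) :=
        expect_pi_two (k := k) fun σ τ : Perm (Fin n) => ind (records σ τ < har n / 2)
    _ ≤ _ := Finset.expect_le Finset.univ_nonempty fun σ _ => freq_records_lt_le σ hH

lemma har_le_expect_maxima (hm : 2 ≤ m) :
    har n ≤ 𝔼 c : Fin m → Perm (Fin n), (maxima c : ℝ) := by
  obtain ⟨k, rfl⟩ := Nat.exists_eq_add_of_le' hm
  calc har n ≤ 𝔼 σ : Perm (Fin n), 𝔼 τ, records σ τ :=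
        Finset.le_expect Finset.univ_nonempty fun σ _ => (expect_records σ).ge
    _ = 𝔼 c : Fin (k + 2) → Perm (Fin n), records (c 0) (c 1) :=
        (expect_pi_two (k := k) records).symm
    _ ≤ _ := expect_le_expect_of_le records_le_maxima

/-! ### Explicit bounds for finite `n` -/

lemma meanSurvivingCol_nonneg (m n : ℕ) : 0 ≤ meanSurvivingCol m n := by
  rw [meanSurvivingCol, expect_eq_expect]
  exact Finset.expect_nonneg fun g _ => Nat.cast_nonneg _

lemma prob_rowReacts_nonneg (m n : ℕ) : 0 ≤ prob m n RowReacts := by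
  rw [prob_eq_freq]; exact freq_nonneg _

lemma prob_le_prob_rowReacts {P : Game m n → Prop} (h : ∀ g, ¬ RowReacts g → ¬ P g) :
    prob m n P ≤ prob m n RowReacts := by
  rw [prob_eq_freq, prob_eq_freq]
  exact freq_mono fun g hg => by_contra fun hr => h g hr hg

lemma prob_rowReacts_le_of_log_pos (hm : 2 ≤ m) (hL : 0 < Real.log n) :
    prob m n RowReacts ≤ (m : ℝ) ^ 2 * 2 ^ (-(Real.log n / 2)) + 4 / Real.log n := by
  have hLH := log_le_har n
  have hH := hL.trans_le hLH
  refine (prob_rowReacts_le (har n / 2)).trans (add_le_add ?_ ?_)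
  · gcongr
    exact one_le_two
  · exact (freq_maxima_lt_har hm hH).trans (by gcongr)

lemma prob_rowReacts_le_of_pos (hn : 0 < n) :
    prob m n RowReacts ≤ (m : ℝ) ^ 2 * 2 ^ (-((n : ℝ) / 2)) + 2 * n * (1 / 2) ^ m :=
  (prob_rowReacts_le ((n : ℝ) / 2)).trans (add_le_add le_rfl (freq_maxima_lt_half hn))

lemma prob_rowReacts_le_uniform (hm : 2 ≤ m) (hmn : m ≤ n) (hL : 0 < Real.log n) :
    prob m n RowReacts ≤ (36 * (Real.log n ^ 2 * 2 ^ (-(Real.log n / 2))) + 4 / Real.log n) +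
      ((n : ℝ) ^ 2 * 2 ^ (-((n : ℝ) / 2)) + 2 / n) := by
  have hn : 0 < n := by omega
  have hn' : (0 : ℝ) < n := Nat.cast_pos.2 hn
  -- Below the threshold `m²` is of order `log² n` and the records bound suffices. Above it, `2 ^
  -- (-m) ≤ n ^ (-2)` because `6 log 2 ≥ 2`.
  rcases le_or_gt (m : ℝ) (6 * Real.log n) with h | h
  · have h1 : (m : ℝ) ^ 2 * 2 ^ (-(Real.log n / 2)) ≤
        36 * (Real.log n ^ 2 * 2 ^ (-(Real.log n / 2))) := by
      rw [← mul_assoc]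
      refine mul_le_mul_of_nonneg_right ?_ (by positivity)
      calc (m : ℝ) ^ 2 ≤ (6 * Real.log n) ^ 2 := by gcongr
        _ = _ := by ring
    have h2 : (0 : ℝ) ≤ (n : ℝ) ^ 2 * 2 ^ (-((n : ℝ) / 2)) + 2 / n := by positivity
    linarith [prob_rowReacts_le_of_log_pos hm hL]
  · have h1 : (m : ℝ) ^ 2 * 2 ^ (-((n : ℝ) / 2)) ≤ (n : ℝ) ^ 2 * 2 ^ (-((n : ℝ) / 2)) := by gcongr
    have h2 : (2 : ℝ) * n * (1 / 2) ^ m ≤ 2 / n := by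
      have h3 : (1 / 2 : ℝ) ^ m ≤ 1 / (n : ℝ) ^ 2 := by
        refine (half_pow_le h.le).trans ?_
        have e : 1 / (n : ℝ) ^ 2 = Real.exp (-(2 * Real.log n)) := by
          rw [Real.exp_neg, two_mul, Real.exp_add, Real.exp_log hn', one_div, sq]
        rw [e, Real.rpow_def_of_pos two_pos]
        apply Real.exp_le_exp.2
        nlinarith [Real.log_two_gt_d9]
      calc (2 : ℝ) * n * (1 / 2) ^ m ≤ 2 * n * (1 / (n : ℝ) ^ 2) := by gcongr
        _ = 2 / n := by field_simp
    have h4 : (0 : ℝ) ≤ 36 * (Real.log n ^ 2 * 2 ^ (-(Real.log n / 2))) + 4 / Real.log n := by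
      positivity
    linarith [prob_rowReacts_le_of_pos (m := m) hn]

/-- The term `n² 2 ^ (-m)` occurs twice: once for the dominated columns, once for the event `maxima
< n / 2`, at the threshold `K = n / 2`. -/
lemma sub_meanSurvivingCol_le (hm : 0 < m) (hmn : m ≤ n) :
    (n : ℝ) - meanSurvivingCol m n ≤
      2 * ((n : ℝ) ^ 2 * (1 / 2) ^ m) + (n : ℝ) ^ 3 * 2 ^ (-((n : ℝ) / 2)) := by
  have h1 := le_expect_maxima (m := m) (n := n)
  have h2 := expect_maxima_sub_meanSurvivingCol_le (n := n) hm ((n : ℝ) / 2)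
  have h3 : 𝔼 c : Fin m → Perm (Fin n), (maxima c : ℝ) ≤ n :=
    Finset.expect_le Finset.univ_nonempty fun c _ => Nat.cast_le.2 (maxima_le c)
  have h4 := mul_le_mul_of_nonneg_left (freq_maxima_lt_half (m := m) (n := n) (by omega))
    (show (0 : ℝ) ≤ (n : ℝ) / 2 by positivity)
  have h5 : (m : ℝ) ^ 2 * 2 ^ (-((n : ℝ) / 2)) *
      (𝔼 c : Fin m → Perm (Fin n), (maxima c : ℝ)) ≤
      (n : ℝ) ^ 2 * 2 ^ (-((n : ℝ) / 2)) * n := by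
    refine mul_le_mul ?_ h3 (Finset.expect_nonneg fun c _ => Nat.cast_nonneg _) (by positivity)
    gcongr
  have h6 : (n : ℝ) / 2 * (2 * n * (1 / 2) ^ m) = (n : ℝ) ^ 2 * (1 / 2) ^ m := by ring
  have h7 : (n : ℝ) ^ 2 * 2 ^ (-((n : ℝ) / 2)) * n = (n : ℝ) ^ 3 * 2 ^ (-((n : ℝ) / 2)) := by ring
  linarith

lemma meanSurvivingCol_le_card (hm : 0 < m) : meanSurvivingCol m n ≤ n :=
  (meanSurvivingCol_le hm).trans
    (Finset.expect_le Finset.univ_nonempty fun c _ => Nat.cast_le.2 (maxima_le c))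

/-! ### Limits -/

lemma tendsto_pow_mul_two_rpow (k : ℕ) :
    Tendsto (fun x : ℝ => x ^ k * 2 ^ (-(x / 2))) atTop (𝓝 0) := by
  have hb : 0 < Real.log 2 / 2 := by have := Real.log_pos one_lt_two; positivity
  refine (isLittleO_pow_exp_pos_mul_atTop k hb).tendsto_div_nhds_zero.congr fun x => ?_
  rw [Real.rpow_def_of_pos two_pos, div_eq_mul_inv, ← Real.exp_neg]
  congr 2
  ring

lemma tendsto_log_cast : Tendsto (fun n : ℕ => Real.log n) atTop atTop :=
  Real.tendsto_log_atTop.comp tendsto_natCast_atTop_atTop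

lemma tendsto_prob_rowReacts (m : ℕ → ℕ) (hm : ∀ n : ℕ, 2 ≤ n → 2 ≤ m n ∧ m n ≤ n) :
    Tendsto (fun n => prob (m n) n RowReacts) atTop (𝓝 0) := by
  have hlim : Tendsto (fun n : ℕ =>
      (36 * (Real.log n ^ 2 * 2 ^ (-(Real.log n / 2))) + 4 / Real.log n) +
      ((n : ℝ) ^ 2 * 2 ^ (-((n : ℝ) / 2)) + 2 / n)) atTop (𝓝 0) := by
    have h1 := ((tendsto_pow_mul_two_rpow 2).comp tendsto_log_cast).const_mul 36
    have h2 := tendsto_log_cast.const_div_atTop 4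
    have h3 := (tendsto_pow_mul_two_rpow 2).comp (tendsto_natCast_atTop_atTop (R := ℝ))
    have h4 := (tendsto_natCast_atTop_atTop (R := ℝ)).const_div_atTop 2
    simpa using (h1.add h2).add (h3.add h4)
  refine tendsto_of_tendsto_of_tendsto_of_le_of_le' tendsto_const_nhds hlim
    (Eventually.of_forall fun n => prob_rowReacts_nonneg _ _) ?_
  filter_upwards [eventually_ge_atTop 2, tendsto_log_cast.eventually_gt_atTop 0] with n hn hL
  exact prob_rowReacts_le_uniform (hm n hn).1 (hm n hn).2 hL

lemma tendsto_pow_mul_half_pow (m : ℕ → ℕ) (a : ℕ)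
    (h : Tendsto (fun n : ℕ => (m n : ℝ) - a * Real.logb 2 n) atTop atTop) :
    Tendsto (fun n : ℕ => (n : ℝ) ^ a * (1 / 2) ^ m n) atTop (𝓝 0) := by
  have h1 : Tendsto (fun x : ℝ => (2 : ℝ) ^ (-x)) atTop (𝓝 0) :=
    (tendsto_rpow_atBot_of_base_gt_one 2 one_lt_two).comp tendsto_neg_atTop_atBot
  refine (h1.comp h).congr' ?_
  filter_upwards [eventually_gt_atTop 0] with n hn
  have hn' : (0 : ℝ) < n := Nat.cast_pos.2 hn
  rw [Function.comp_apply, neg_sub, Real.rpow_sub two_pos, mul_comm, Real.rpow_mul zero_le_two,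
    Real.rpow_logb two_pos (by norm_num) hn', Real.rpow_natCast, Real.rpow_natCast,
    div_eq_mul_inv, one_div, inv_pow]

lemma tendsto_sub_meanSurvivingCol (m : ℕ → ℕ) (hm : ∀ n : ℕ, 2 ≤ n → 2 ≤ m n ∧ m n ≤ n)
    (h : Tendsto (fun n : ℕ => (m n : ℝ) - 2 * Real.logb 2 n) atTop atTop) :
    Tendsto (fun n : ℕ => (n : ℝ) - meanSurvivingCol (m n) n) atTop (𝓝 0) := by
  have h1 := (tendsto_pow_mul_half_pow m 2 (by simpa using h)).const_mul 2
  have h2 := (tendsto_pow_mul_two_rpow 3).comp (tendsto_natCast_atTop_atTop (R := ℝ))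
  have hlim := h1.add h2
  rw [mul_zero, add_zero] at hlim
  refine tendsto_of_tendsto_of_tendsto_of_le_of_le' tendsto_const_nhds hlim ?_ ?_
  · filter_upwards [eventually_ge_atTop 2] with n hn
    exact sub_nonneg.2 (meanSurvivingCol_le_card (by linarith [(hm n hn).1]))
  · filter_upwards [eventually_ge_atTop 2] with n hn
    exact sub_meanSurvivingCol_le (by linarith [(hm n hn).1]) (hm n hn).2

lemma tendsto_meanSurvivingCol_div_one (m : ℕ → ℕ) (hm : ∀ n : ℕ, 2 ≤ n → 2 ≤ m n ∧ m n ≤ n)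
    (h : Tendsto (fun n : ℕ => (m n : ℝ) - Real.logb 2 n) atTop atTop) :
    Tendsto (fun n : ℕ => meanSurvivingCol (m n) n / (n : ℝ)) atTop (𝓝 1) := by
  have h1 := (tendsto_pow_mul_half_pow m 1 (by simpa using h)).const_mul 2
  have h2 := (tendsto_pow_mul_two_rpow 2).comp (tendsto_natCast_atTop_atTop (R := ℝ))
  have hlim := tendsto_const_nhds (x := (1 : ℝ)) |>.sub (h1.add h2)
  rw [mul_zero, add_zero, sub_zero] at hlim
  refine tendsto_of_tendsto_of_tendsto_of_le_of_le' hlim tendsto_const_nhds ?_ ?_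
  · filter_upwards [eventually_ge_atTop 2] with n hn
    have hn' : (0 : ℝ) < n := Nat.cast_pos.2 (by omega)
    have := sub_meanSurvivingCol_le (show 0 < m n by linarith [(hm n hn).1]) (hm n hn).2
    rw [le_div_iff₀ hn', Function.comp_apply]
    have e : (1 - (2 * ((n : ℝ) ^ 1 * (1 / 2) ^ m n) + (n : ℝ) ^ 2 * 2 ^ (-((n : ℝ) / 2)))) * n =
      n - (2 * ((n : ℝ) ^ 2 * (1 / 2) ^ m n) + (n : ℝ) ^ 3 * 2 ^ (-((n : ℝ) / 2))) := by ring
    rw [e]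
    linarith
  · filter_upwards [eventually_ge_atTop 2] with n hn
    exact div_le_one_of_le₀ (meanSurvivingCol_le_card (by linarith [(hm n hn).1]))
      (Nat.cast_nonneg n)

lemma normalized_meanSurvivingCol_le (hm : 0 < m) (hL : 0 < Real.log n)
    (hmL : (m : ℝ) ≤ Real.log n / 2) :
    ((m - 1).factorial : ℝ) / Real.log n ^ (m - 1) * meanSurvivingCol m n ≤
      Real.exp (m / Real.log n + 4 * (m / Real.log n) ^ 2) := by
  obtain ⟨k, rfl⟩ := Nat.exists_eq_add_of_le' hm
  have hn : 0 < n := by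
    rcases Nat.eq_zero_or_pos n with rfl | h
    · simp at hL
    · exact h
  have hLH := log_le_har n
  have hH := hL.trans_le hLH
  rw [Nat.add_sub_cancel]
  have hk : (k : ℝ) ≤ (k + 1 : ℕ) := by push_cast; linarith
  have h1 := (meanSurvivingCol_le (n := n) hm).trans_eq (expect_maxima_eq_hsum k hn)
  have h2 := h1.trans (hsum_le hH (by linarith))
  have hf : (k.factorial : ℝ) ≠ 0 := by exact_mod_cast k.factorial_ne_zero
  calc (k.factorial : ℝ) / Real.log n ^ k * meanSurvivingCol (k + 1) n
      ≤ (k.factorial : ℝ) / Real.log n ^ k *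
          (har n ^ k / k.factorial * Real.exp (4 * (k / har n) ^ 2)) := by gcongr
    _ = (har n / Real.log n) ^ k * Real.exp (4 * (k / har n) ^ 2) := by
        field_simp
        rw [← mul_pow, mul_div_cancel₀ _ hL.ne']
    _ ≤ Real.exp (1 / Real.log n) ^ k *
          Real.exp (4 * (((k + 1 : ℕ) : ℝ) / Real.log n) ^ 2) := by
        -- `har n ≤ 1 + log n` makes the ratio at most `1 + 1 / log n`, so its `k`-th power is
        -- harmless when `k = o(log n)`.
        have h3 : har n / Real.log n ≤ Real.exp (1 / Real.log n) := by
          refine le_trans ?_ (Real.add_one_le_exp _)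
          rw [div_le_iff₀ hL, add_mul, one_div, inv_mul_cancel₀ hL.ne', one_mul]
          exact har_le n
        gcongr
    _ = Real.exp (k / Real.log n + 4 * (((k + 1 : ℕ) : ℝ) / Real.log n) ^ 2) := by
        rw [← Real.exp_nat_mul, ← Real.exp_add, mul_one_div]
    _ ≤ _ := by gcongr

lemma le_normalized_meanSurvivingCol (hm : 2 ≤ m) (hL : 0 < Real.log n)
    (hmL : (m : ℝ) ≤ Real.log n) :
    1 - (Real.log n ^ 2 * 2 ^ (-(Real.log n / 2)) + 2 / Real.log n) ≤
      ((m - 1).factorial : ℝ) / Real.log n ^ (m - 1) * meanSurvivingCol m n := by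
  obtain ⟨k, rfl⟩ := Nat.exists_eq_add_of_le' (show 1 ≤ m by omega)
  have hn : 0 < n := by
    rcases Nat.eq_zero_or_pos n with rfl | h
    · simp at hL
    · exact h
  have hLH := log_le_har n
  have hH := hL.trans_le hLH
  rw [Nat.add_sub_cancel]
  set ε := Real.log n ^ 2 * 2 ^ (-(Real.log n / 2)) + 2 / Real.log n with hε
  have hf : (k.factorial : ℝ) ≠ 0 := by exact_mod_cast k.factorial_ne_zero
  have h1 := expect_maxima_sub_meanSurvivingCol_le (n := n) (show 0 < k + 1 by omega) (har n / 2)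
  have h2 := har_le_expect_maxima (n := n) hm
  rw [expect_maxima_eq_hsum k hn] at h1 h2
  have h3 : har n / 2 * freq (fun c : Fin (k + 1) → Perm (Fin n) => (maxima c : ℝ) < har n / 2) ≤
      2 := by
    refine (mul_le_mul_of_nonneg_left (freq_maxima_lt_har hm hH) (by positivity)).trans_eq ?_
    field_simp
    norm_num
  -- The additive error `2` becomes a relative one because `hsum k n ≥ har n ≥ log n`; this is where
  -- the summand `2 / log n` of `ε` comes from.
  have h4 : (2 : ℝ) ≤ 2 / Real.log n * hsum k n := by
    rw [div_mul_eq_mul_div, le_div_iff₀ hL]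
    linarith
  have h5 : ((k + 1 : ℕ) : ℝ) ^ 2 * 2 ^ (-(har n / 2)) * hsum k n ≤
      Real.log n ^ 2 * 2 ^ (-(Real.log n / 2)) * hsum k n := by
    refine mul_le_mul_of_nonneg_right ?_ (hsum_nonneg _ _)
    gcongr
    exact one_le_two
  have h6 : (1 - ε) * hsum k n ≤ meanSurvivingCol (k + 1) n := by
    rw [hε]; linarith
  rcases le_or_gt (1 - ε) 0 with h | h
  · exact h.trans (mul_nonneg (by positivity) (meanSurvivingCol_nonneg _ _))
  · have h7 : Real.log n ^ k / k.factorial ≤ hsum k n :=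
      le_trans (by gcongr) (har_pow_div_factorial_le k n)
    calc 1 - ε = (k.factorial : ℝ) / Real.log n ^ k *
          ((1 - ε) * (Real.log n ^ k / k.factorial)) := by field_simp
      _ ≤ (k.factorial : ℝ) / Real.log n ^ k * ((1 - ε) * hsum k n) := by gcongr
      _ ≤ _ := by gcongr

lemma tendsto_normalized_meanSurvivingCol (m : ℕ → ℕ) (hm : ∀ n : ℕ, 2 ≤ n → 2 ≤ m n ∧ m n ≤ n)
    (h : (fun n : ℕ => (m n : ℝ)) =o[atTop] (fun n : ℕ => Real.log (n : ℝ))) :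
    Tendsto (fun n : ℕ => ((m n - 1).factorial : ℝ) / Real.log (n : ℝ) ^ (m n - 1) *
      meanSurvivingCol (m n) n) atTop (𝓝 1) := by
  have hd := h.tendsto_div_nhds_zero
  have hup : Tendsto (fun n : ℕ => Real.exp (m n / Real.log n + 4 * (m n / Real.log n) ^ 2))
      atTop (𝓝 1) := by
    have := (hd.add ((hd.pow 2).const_mul 4)).rexp
    simpa using this
  have hlow : Tendsto (fun n : ℕ => 1 - (Real.log n ^ 2 * 2 ^ (-(Real.log n / 2)) +
      2 / Real.log n)) atTop (𝓝 1) := by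
    have h1 := (tendsto_pow_mul_two_rpow 2).comp tendsto_log_cast
    have h2 := tendsto_log_cast.const_div_atTop 2
    have := (tendsto_const_nhds (x := (1 : ℝ))).sub (h1.add h2)
    simpa using this
  have hev : ∀ᶠ n : ℕ in atTop, (m n : ℝ) ≤ Real.log n / 2 := by
    filter_upwards [hd.eventually_lt_const (show (0 : ℝ) < 1 / 2 by norm_num),
      tendsto_log_cast.eventually_gt_atTop 0] with n hn hL
    rw [div_lt_iff₀ hL] at hn
    linarith
  refine tendsto_of_tendsto_of_tendsto_of_le_of_le' hlow hup ?_ ?_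
  · filter_upwards [eventually_ge_atTop 2, tendsto_log_cast.eventually_gt_atTop 0, hev]
      with n hn hL hmL
    exact le_normalized_meanSurvivingCol (hm n hn).1 hL (by linarith)
  · filter_upwards [eventually_ge_atTop 2, tendsto_log_cast.eventually_gt_atTop 0, hev]
      with n hn hL hmL
    exact normalized_meanSurvivingCol_le (by linarith [(hm n hn).1]) hL hmL

lemma tendsto_meanSurvivingCol_div_zero (m : ℕ → ℕ) (hm : ∀ n : ℕ, 2 ≤ n → 2 ≤ m n ∧ m n ≤ n)
    (h : (fun n : ℕ => (m n : ℝ)) =o[atTop] (fun n : ℕ => Real.log (n : ℝ))) :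
    Tendsto (fun n : ℕ => meanSurvivingCol (m n) n / (n : ℝ)) atTop (𝓝 0) := by
  have hX := tendsto_normalized_meanSurvivingCol m hm h
  have hd := h.tendsto_div_nhds_zero
  have hY : Tendsto (fun n : ℕ => Real.log n ^ (m n - 1) / (m n - 1).factorial / (n : ℝ))
      atTop (𝓝 0) := by
    have hexp : Tendsto (fun n : ℕ => Real.exp (-(Real.log n / 4))) atTop (𝓝 0) :=
      Real.tendsto_exp_neg_atTop_nhds_zero.comp (tendsto_log_cast.atTop_div_const (by norm_num))
    refine tendsto_of_tendsto_of_tendsto_of_le_of_le' tendsto_const_nhds hexp ?_ ?_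
    · filter_upwards [tendsto_log_cast.eventually_gt_atTop 0] with n hL
      positivity
    · filter_upwards [eventually_gt_atTop 0, tendsto_log_cast.eventually_gt_atTop 0,
        hd.eventually_lt_const (show (0 : ℝ) < 1 / 4 by norm_num)] with n hn hL hmL
      rw [div_lt_iff₀ hL] at hmL
      have hn' : (0 : ℝ) < n := Nat.cast_pos.2 hn
      set k := m n - 1 with hk
      have hkm : (k : ℝ) ≤ m n := Nat.cast_le.2 (Nat.sub_le _ _)
      have h1 : (2 : ℝ) ^ k ≤ Real.exp k := by
        rw [← Real.exp_one_pow]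
        exact pow_le_pow_left₀ zero_le_two (by linarith [Real.exp_one_gt_d9]) k
      have h2 := Real.pow_div_factorial_le_exp (Real.log n / 2) (by positivity) k
      rw [div_le_iff₀ hn']
      -- Halving `log n` leaves room: `2 ^ k ≤ exp k` and `k < log n / 4` give `exp (3 log n / 4)`
      -- in total, which is `n` times `exp (-(log n / 4))`.
      calc Real.log n ^ k / k.factorial = 2 ^ k * ((Real.log n / 2) ^ k / k.factorial) := by
            rw [div_pow]; field_simp
        _ ≤ Real.exp k * Real.exp (Real.log n / 2) := by gcongr
        _ ≤ Real.exp (-(Real.log n / 4)) * Real.exp (Real.log n) := by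
            rw [← Real.exp_add, ← Real.exp_add]
            apply Real.exp_le_exp.2
            linarith
        _ = _ := by rw [Real.exp_log hn']
  have := hX.mul hY
  rw [mul_zero] at this
  refine this.congr' ?_
  filter_upwards [tendsto_log_cast.eventually_gt_atTop 0] with n hL
  have hf : ((m n - 1).factorial : ℝ) ≠ 0 := by exact_mod_cast (m n - 1).factorial_ne_zero
  field_simp

end RandomGame

end

theorem theorem2 (m : ℕ → ℕ) (hm : ∀ n : ℕ, 2 ≤ n → 2 ≤ m n ∧ m n ≤ n) :
    -- Row eliminates no action, and Column none after the first iteration, w.h.p.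
    (Tendsto (fun n : ℕ => RandomGame.prob (m n) n
        (fun g => RandomGame.survivingRow g < m n)) atTop (𝓝 0) ∧
      Tendsto (fun n : ℕ => RandomGame.prob (m n) n
        (fun g => ∃ k : ℕ, 1 ≤ k ∧
          (RandomGame.remaining g (k + 1)).2 ≠ (RandomGame.remaining g k).2)) atTop (𝓝 0)) ∧
    -- the case `m = o(ln n)`
    ((fun n : ℕ => (m n : ℝ)) =o[atTop] (fun n : ℕ => Real.log (n : ℝ)) →
      Tendsto (fun n : ℕ => ((m n - 1).factorial : ℝ) / Real.log (n : ℝ) ^ (m n - 1) *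
          RandomGame.meanSurvivingCol (m n) n) atTop (𝓝 1) ∧
      Tendsto (fun n : ℕ => RandomGame.meanSurvivingCol (m n) n / (n : ℝ)) atTop (𝓝 0)) ∧
    -- the case `m = log₂ n + ω(1)`
    (Tendsto (fun n : ℕ => (m n : ℝ) - Real.logb 2 (n : ℝ)) atTop atTop →
      Tendsto (fun n : ℕ => RandomGame.meanSurvivingCol (m n) n / (n : ℝ)) atTop (𝓝 1)) ∧
    -- the case `m = 2 log₂ n + ω(1)`
    (Tendsto (fun n : ℕ => (m n : ℝ) - 2 * Real.logb 2 (n : ℝ)) atTop atTop →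
      Tendsto (fun n : ℕ => (n : ℝ) - RandomGame.meanSurvivingCol (m n) n) atTop (𝓝 0)) := by
  refine ⟨⟨?_, ?_⟩, fun h => ⟨RandomGame.tendsto_normalized_meanSurvivingCol m hm h,
    RandomGame.tendsto_meanSurvivingCol_div_zero m hm h⟩,
    RandomGame.tendsto_meanSurvivingCol_div_one m hm,
    RandomGame.tendsto_sub_meanSurvivingCol m hm⟩
  · refine tendsto_of_tendsto_of_tendsto_of_le_of_le' tendsto_const_nhds
      (RandomGame.tendsto_prob_rowReacts m hm)
      (Eventually.of_forall fun n => div_nonneg (Nat.cast_nonneg _) (Nat.cast_nonneg _)) ?_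
    filter_upwards [eventually_ge_atTop 2] with n hn
    refine RandomGame.prob_le_prob_rowReacts fun g hg => ?_
    rw [RandomGame.survivingRow_of_not_rowReacts (by linarith [(hm n hn).1]) hg]
    exact lt_irrefl _
  · refine tendsto_of_tendsto_of_tendsto_of_le_of_le' tendsto_const_nhds
      (RandomGame.tendsto_prob_rowReacts m hm)
      (Eventually.of_forall fun n => div_nonneg (Nat.cast_nonneg _) (Nat.cast_nonneg _)) ?_
    filter_upwards [eventually_ge_atTop 2] with n hn
    refine RandomGame.prob_le_prob_rowReacts fun g hg => ?_
    have hm0 : 0 < m n := by linarith [(hm n hn).1]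
    rintro ⟨k, hk, hne⟩
    obtain ⟨k, rfl⟩ := Nat.exists_eq_add_of_le' hk
    rw [RandomGame.remaining_of_not_rowReacts hm0 hg,
      RandomGame.remaining_of_not_rowReacts hm0 hg] at hne
    exact hne rfl
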